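/- Let $n = p^{\alpha}$ with $p$ a prime and $\alpha \ge 0$ an integer (so $n=1$ is allowed). Let $r \ge 0$ and $s \ge 1$ be integers with $r \not\equiv s \pmod 2$. For $1 \le k \le n$ put $B_{n,k} = \frac{k}{n}\binom{2n}{n-k}$. Then $$\binom{2n}{n}^{-1} \sum_{k=1}^{n} k^{r} B_{n,k}^{s}$$ is either an integer or a half-integer, where a half-integer is a number of the form $m + \tfrac12$ with $m$ an integer. -/

import Mathlib

/-- The entry `B_{n,k} = (k/n) * C(2n, n-k)` of the Catalan triangle, as a rational number.
It is meant for `1 ≤ k ≤ n`, where the subtraction `n - k` is a true one. -/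
def catalanTriangle (n k : ℕ) : ℚ :=
  (k : ℚ) / (n : ℚ) * ((2 * n).choose (n - k) : ℚ)

/-- A rational number is a half-integer if it is of the form `m + 1/2` with `m` an integer. -/
def IsHalfInteger (q : ℚ) : Prop := ∃ m : ℤ, q = (m : ℚ) + 1 / 2

open Finset

/-! Write ρ_j(k) for `centralRatio j k` and r + s = 2t + 1. Clearing n^s turns the sum N into ∑
k^(2t+1) C(2n, n+k)^s. Vandermonde expands C(2n, n+k)^s as C(2n, n) times an integer combination of
the C(n, j) ρ_j(k), and twice an odd moment of ρ_j is an integer. So C(2n, n) divides 2 n^s N, for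
every n > 0. Only now does n = p^a enter: C(2n, n) = 2 C(2n-1, n-1), and by Lucas C(2n-1, n-1) is
prime to p, so it divides the integer N and the quotient is u/2. -/

/-- The binomial coefficient `C(2j, j+k)` normalized by the central one. -/
def centralRatio (j k : ℕ) : ℚ := ((2 * j).choose (j + k) : ℚ) / ((2 * j).choose j : ℚ)

lemma centralRatio_eq_zero {j k : ℕ} (h : j < k) : centralRatio j k = 0 := by
  simp [centralRatio, Nat.choose_eq_zero_of_lt (show 2 * j < j + k by omega)]

lemma choose_two_mul_ne_zero (j : ℕ) : ((2 * j).choose j : ℚ) ≠ 0 :=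
  Nat.cast_ne_zero.2 (Nat.choose_pos (by omega)).ne'

lemma centralRatio_zero_right (j : ℕ) : centralRatio j 0 = 1 :=
  div_self (choose_two_mul_ne_zero j)

lemma cast_choose_two_mul (d k : ℕ) :
    ((2 * (k + d)).choose (k + d + k) : ℚ) =
      ((2 * (k + d)).factorial : ℚ) / ((k + d + k).factorial * d.factorial) := by
  have h : 2 * (k + d) = (k + d + k) + d := by ring
  rw [h, Nat.cast_add_choose]

lemma centralRatio_add (d k : ℕ) :
    centralRatio (k + d) k =
      ((k + d).factorial : ℚ) ^ 2 / ((k + d + k).factorial * d.factorial) := by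
  have h := cast_choose_two_mul (k + d) 0
  simp only [zero_add, add_zero] at h
  rw [centralRatio, cast_choose_two_mul, h]
  have := fun m : ℕ => (Nat.cast_ne_zero (R := ℚ)).2 m.factorial_ne_zero
  have h1 := this (2 * (k + d))
  have h2 := this (k + d)
  field_simp

lemma centralRatio_succ_right (j k : ℕ) :
    ((j : ℚ) + k + 1) * centralRatio j (k + 1) = ((j : ℚ) - k) * centralRatio j k := by
  rcases le_or_gt k j with h | h
  · have := Nat.choose_succ_right_eq (2 * j) (j + k)
    rw [show 2 * j - (j + k) = j - k by omega] at this
    have h2 : (((2 * j).choose (j + k + 1) : ℚ)) * (j + k + 1) =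
        (2 * j).choose (j + k) * ((j : ℚ) - k) := by
      rw [← Nat.cast_sub h]; exact_mod_cast this
    unfold centralRatio
    rw [← add_assoc, mul_div_assoc', mul_div_assoc', mul_comm, h2, mul_comm]
  · simp [centralRatio_eq_zero h, centralRatio_eq_zero (Nat.lt_succ_of_lt h)]

/-- This trades k² ρ_{j+1} for (j+1)² (ρ_{j+1} - ρ_j), lowering the order of a moment by two. -/
lemma sq_sub_sq_mul_centralRatio (j k : ℕ) :
    (((j : ℚ) + 1) ^ 2 - k ^ 2) * centralRatio (j + 1) k = ((j : ℚ) + 1) ^ 2 * centralRatio j k := by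
  rcases lt_trichotomy k (j + 1) with h | rfl | h
  · obtain ⟨d, rfl⟩ := Nat.exists_eq_add_of_le (Nat.lt_succ_iff.1 h)
    rw [centralRatio_add, add_assoc k d 1, centralRatio_add]
    have h2 : k + (d + 1) + k = (k + d + k) + 1 := by ring
    rw [h2, ← add_assoc k d 1]
    simp only [Nat.factorial_succ]
    have := fun m : ℕ => (Nat.cast_ne_zero (R := ℚ)).2 m.factorial_ne_zero
    have h3 := this (k + d + k)
    have h4 := this d
    push_cast
    field_simp
    ring
  · rw [centralRatio_eq_zero (Nat.lt_succ_self j)]; push_cast; ring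
  · rw [centralRatio_eq_zero h, centralRatio_eq_zero (by omega : j < k)]; ring

/-- The sum telescopes: 2k ρ_j(k) = (j+k) ρ_j(k) - (j+k+1) ρ_j(k+1). -/
lemma two_mul_sum_mul_centralRatio {j N : ℕ} (h : j ≤ N) :
    2 * ∑ k ∈ range (N + 1), (k : ℚ) * centralRatio j k = j := by
  have key := Finset.sum_range_sub' (fun k : ℕ => ((j : ℚ) + k) * centralRatio j k) (N + 1)
  rw [centralRatio_eq_zero (by omega : j < N + 1), centralRatio_zero_right] at key
  rw [mul_sum]
  convert key using 1
  · refine sum_congr rfl fun k _ => ?_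
    have := centralRatio_succ_right j k
    push_cast
    linear_combination this
  · simp

/-- Twice an odd moment of the normalized binomial coefficients is an integer. -/
lemma exists_int_odd_moment (t : ℕ) : ∀ {j N : ℕ}, j ≤ N → ∃ z : ℤ,
    2 * ∑ k ∈ range (N + 1), (k : ℚ) ^ (2 * t + 1) * centralRatio j k = z := by
  induction t with
  | zero => exact fun {j N} h => ⟨j, by simpa using two_mul_sum_mul_centralRatio h⟩
  | succ t ih =>
    intro j N h
    cases j with
    | zero =>
      refine ⟨0, ?_⟩
      rw [sum_eq_zero, mul_zero, Int.cast_zero]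
      intro k _
      rcases Nat.eq_zero_or_pos k with rfl | hk
      · simp
      · rw [centralRatio_eq_zero hk, mul_zero]
    | succ j =>
      obtain ⟨a, ha⟩ := ih h
      obtain ⟨b, hb⟩ := ih (Nat.le_of_succ_le h)
      refine ⟨((j : ℤ) + 1) ^ 2 * (a - b), ?_⟩
      push_cast
      rw [← ha, ← hb, ← mul_sub, ← sum_sub_distrib, mul_left_comm]
      congr 1
      rw [mul_sum]
      refine sum_congr rfl fun k _ => ?_
      linear_combination (-(k : ℚ) ^ (2 * t + 1)) * sq_sub_sq_mul_centralRatio j k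

/-- Linearization of a product of two binomial coefficients, from Vandermonde's identity. -/
lemma choose_mul_centralRatio_mul {n j : ℕ} (h : j ≤ n) (k : ℕ) :
    (n.choose j : ℚ) * centralRatio j k * ((2 * n).choose (n + k) : ℚ) =
      ∑ i ∈ range (j + 1), (j.choose i : ℚ) * ((2 * n).choose (n - j) : ℚ) *
        ((n.choose i : ℚ) * centralRatio i k) := by
  rcases lt_or_ge j k with hk | hk
  · rw [centralRatio_eq_zero hk, sum_eq_zero]
    · ring
    · intro i hi
      rw [centralRatio_eq_zero (by rw [mem_range] at hi; omega), mul_zero, mul_zero]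
  obtain ⟨d, rfl⟩ := Nat.exists_eq_add_of_le hk
  obtain ⟨z, rfl⟩ := Nat.exists_eq_add_of_le h
  -- Terms with i < k vanish; the others are indexed by i = k + x.
  rw [add_assoc k d 1, sum_range_add, sum_eq_zero, zero_add]
  swap
  · intro i hi
    rw [centralRatio_eq_zero (mem_range.1 hi), mul_zero, mul_zero]
  have fne := fun m : ℕ => (Nat.cast_ne_zero (R := ℚ)).2 m.factorial_ne_zero
  have van := Nat.add_choose_eq (d + z) (k + d + k) d
  rw [Finset.Nat.sum_antidiagonal_eq_sum_range_succ_mk] at van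
  have van2 : (((d + z + (k + d + k)).choose d : ℕ) : ℚ) =
      ∑ x ∈ range (d + 1), ((d + z).choose x : ℚ) * ((k + d + k).choose (d - x) : ℚ) := by
    rw [van]; push_cast; rfl
  have e1 : ((k + d + z).choose (k + d) : ℚ) =
      (k + d + z).factorial / ((k + d).factorial * z.factorial) := Nat.cast_add_choose ℚ
  have e2 : ((2 * (k + d + z)).choose (k + d + z + k) : ℚ) =
      (2 * (k + d + z)).factorial / ((k + d + z + k).factorial * (d + z).factorial) := by
    rw [show k + d + z = k + (d + z) by ring, cast_choose_two_mul]
  have e3 : ((2 * (k + d + z)).choose (k + d + z - (k + d)) : ℚ) =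
      (2 * (k + d + z)).factorial / (z.factorial * (2 * (k + d) + z).factorial) := by
    rw [show k + d + z - (k + d) = z by omega,
      show 2 * (k + d + z) = z + (2 * (k + d) + z) by ring, Nat.cast_add_choose]
  have e4 : (((d + z + (k + d + k)).choose d : ℕ) : ℚ) =
      (2 * (k + d) + z).factorial / (d.factorial * (k + d + z + k).factorial) := by
    rw [show d + z + (k + d + k) = d + (k + d + z + k) by ring, Nat.cast_add_choose,
      show d + (k + d + z + k) = 2 * (k + d) + z by ring]
  -- Each summand is a factor free of x times a Vandermonde summand of `van2`.
  have key : ∀ x ∈ range (d + 1), ((k + d).choose (k + x) : ℚ) *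
      ((2 * (k + d + z)).choose (k + d + z - (k + d)) : ℚ) *
        (((k + d + z).choose (k + x) : ℚ) * centralRatio (k + x) k) =
      ((k + d + z).choose (k + d) : ℚ) * centralRatio (k + d) k *
        ((2 * (k + d + z)).choose (k + d + z + k) : ℚ) /
          (((d + z + (k + d + k)).choose d : ℕ) : ℚ) *
        (((d + z).choose x : ℚ) * ((k + d + k).choose (d - x) : ℚ)) := by
    intro x hx
    obtain ⟨y, rfl⟩ := Nat.exists_eq_add_of_le (Nat.lt_succ_iff.1 (mem_range.1 hx))
    have e5 : ((k + (x + y)).choose (k + x) : ℚ) =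
        (k + (x + y)).factorial / ((k + x).factorial * y.factorial) := by
      rw [← add_assoc, Nat.cast_add_choose]
    have e6 : ((k + (x + y) + z).choose (k + x) : ℚ) =
        (k + (x + y) + z).factorial / ((k + x).factorial * (y + z).factorial) := by
      rw [show k + (x + y) + z = (k + x) + (y + z) by ring, Nat.cast_add_choose]
    have e7 : ((x + y + z).choose x : ℚ) =
        (x + y + z).factorial / (x.factorial * (y + z).factorial) := by
      rw [add_assoc, Nat.cast_add_choose]
    have e8 : ((k + (x + y) + k).choose (x + y - x) : ℚ) =
        (k + (x + y) + k).factorial / (y.factorial * (k + x + k).factorial) := by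
      rw [show k + (x + y) + k = y + (k + x + k) by ring, Nat.add_sub_cancel_left,
        Nat.cast_add_choose]
    rw [e1, e2, e3, e4, e5, e6, e7, e8, centralRatio_add, centralRatio_add]
    have h1 := fne (k + (x + y))
    have h2 := fne (k + (x + y) + z)
    have h3 := fne (2 * (k + (x + y) + z))
    have h4 := fne (k + x)
    have h5 := fne (x + y + z)
    have h6 := fne (k + (x + y) + k)
    have h7 := fne (k + x + k)
    have h8 := fne (k + (x + y) + z + k)
    have h9 := fne (2 * (k + (x + y)) + z)
    have h10 := fne x
    have h11 := fne y
    have h12 := fne z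
    have h13 := fne (y + z)
    have h14 := fne (x + y)
    generalize ((k + (x + y)).factorial : ℚ) = a1 at *
    generalize ((k + (x + y) + z).factorial : ℚ) = a2 at *
    generalize ((2 * (k + (x + y) + z)).factorial : ℚ) = a3 at *
    generalize ((k + x).factorial : ℚ) = a4 at *
    generalize ((x + y + z).factorial : ℚ) = a5 at *
    generalize ((k + (x + y) + k).factorial : ℚ) = a6 at *
    generalize ((k + x + k).factorial : ℚ) = a7 at *
    generalize ((k + (x + y) + z + k).factorial : ℚ) = a8 at *
    generalize ((2 * (k + (x + y)) + z).factorial : ℚ) = a9 at *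
    field_simp
  rw [sum_congr rfl key, ← mul_sum, ← van2, div_mul_cancel₀]
  exact Nat.cast_ne_zero.2 (Nat.choose_pos (by omega)).ne'

/-- Powers of `C(2n, n+k)` are `C(2n, n)` times an integer combination, with coefficients
independent of `k`, of the numbers `C(n, j) * centralRatio j k`. -/
lemma exists_choose_pow_expansion (n s : ℕ) : ∃ c : ℕ → ℤ, ∀ k : ℕ,
    ((2 * n).choose (n + k) : ℚ) ^ (s + 1) = ((2 * n).choose n : ℚ) *
      ∑ j ∈ range (n + 1), (c j : ℚ) * ((n.choose j : ℚ) * centralRatio j k) := by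
  induction s with
  | zero =>
    refine ⟨fun j => if j = n then 1 else 0, fun k => ?_⟩
    rw [sum_eq_single n]
    · simp [centralRatio, mul_div_cancel₀ _ (choose_two_mul_ne_zero n)]
    · intro j _ hj; simp [hj]
    · simp
  | succ s ih =>
    obtain ⟨c, hc⟩ := ih
    refine ⟨fun i => ∑ j ∈ range (n + 1), c j * (j.choose i * (2 * n).choose (n - j)),
      fun k => ?_⟩
    rw [pow_succ, hc, mul_assoc, sum_mul]
    congr 1
    have : ∀ j ∈ range (n + 1), (c j : ℚ) * ((n.choose j : ℚ) * centralRatio j k) *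
        ((2 * n).choose (n + k) : ℚ) = ∑ i ∈ range (n + 1), (c j : ℚ) *
          ((j.choose i : ℚ) * ((2 * n).choose (n - j) : ℚ) *
            ((n.choose i : ℚ) * centralRatio i k)) := by
      intro j hj
      have hj' := Nat.lt_succ_iff.1 (mem_range.1 hj)
      rw [mul_assoc, choose_mul_centralRatio_mul hj', mul_sum]
      -- The range of i can be made independent of j since C(j, i) = 0 for i > j.
      refine sum_subset (range_mono (Nat.succ_le_succ hj')) fun i _ hi => ?_
      rw [mem_range, not_lt] at hi
      simp [Nat.choose_eq_zero_of_lt hi]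
    rw [sum_congr rfl this, sum_comm]
    refine sum_congr rfl fun i _ => ?_
    push_cast
    rw [sum_mul]
    exact sum_congr rfl fun j _ => by ring

lemma exists_int_sum_odd_pow_mul_choose_pow (n t s : ℕ) : ∃ z : ℤ,
    2 * ∑ k ∈ range (n + 1), (k : ℚ) ^ (2 * t + 1) * ((2 * n).choose (n + k) : ℚ) ^ (s + 1) =
      (2 * n).choose n * z := by
  obtain ⟨c, hc⟩ := exists_choose_pow_expansion n s
  have hm : ∀ j : ℕ, ∃ z : ℤ, j ≤ n →
      2 * ∑ k ∈ range (n + 1), (k : ℚ) ^ (2 * t + 1) * centralRatio j k = z := fun j => by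
    by_cases hj : j ≤ n
    · obtain ⟨z, hz⟩ := exists_int_odd_moment t hj
      exact ⟨z, fun _ => hz⟩
    · exact ⟨0, fun h => absurd h hj⟩
  choose z hz using hm
  refine ⟨∑ j ∈ range (n + 1), c j * (n.choose j * z j), ?_⟩
  have : ∀ k ∈ range (n + 1),
      (k : ℚ) ^ (2 * t + 1) * ((2 * n).choose (n + k) : ℚ) ^ (s + 1) =
      (2 * n).choose n * ∑ j ∈ range (n + 1), (c j : ℚ) * (n.choose j : ℚ) *
        ((k : ℚ) ^ (2 * t + 1) * centralRatio j k) := by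
    intro k _
    rw [hc, mul_left_comm, mul_sum]
    congr 1
    exact sum_congr rfl fun j _ => by ring
  rw [sum_congr rfl this, ← mul_sum, mul_left_comm, sum_comm, mul_sum]
  push_cast
  congr 1
  refine sum_congr rfl fun j hj => ?_
  rw [← hz j (Nat.lt_succ_iff.1 (mem_range.1 hj)), ← mul_sum]
  ring

/-- The last base-p digit of both p·2p^a - 1 and p·p^a - 1 is p - 1; Lucas strips it, leaving the
case of a. -/
lemma choose_two_mul_pow_sub_one_modEq {p : ℕ} (hp : p.Prime) (a : ℕ) :
    (2 * p ^ a - 1).choose (p ^ a - 1) ≡ 1 [MOD p] := by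
  induction a with
  | zero => simp [Nat.ModEq.refl]
  | succ a ih =>
    have : Fact p.Prime := ⟨hp⟩
    have step : ∀ m, 1 ≤ m → (p * m - 1) % p = p - 1 ∧ (p * m - 1) / p = m - 1 := by
      intro m hm
      obtain ⟨m, rfl⟩ := Nat.exists_eq_add_of_le' hm
      have hpos := hp.pos
      have : p * (m + 1) - 1 = (p - 1) + p * m := by rw [Nat.mul_succ]; omega
      rw [this, Nat.add_mul_mod_self_left, Nat.mod_eq_of_lt (by omega),
        Nat.add_mul_div_left _ _ hpos, Nat.div_eq_of_lt (by omega)]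
      simp
    have hpa : 1 ≤ p ^ a := Nat.one_le_pow _ _ hp.pos
    obtain ⟨h1, h2⟩ := step (p ^ a) hpa
    obtain ⟨h3, h4⟩ := step (2 * p ^ a) (by omega)
    have key := Choose.choose_modEq_choose_mod_mul_choose_div_nat (p := p)
      (n := p * (2 * p ^ a) - 1) (k := p * p ^ a - 1)
    rw [h1, h2, h3, h4, Nat.choose_self, one_mul] at key
    rw [pow_succ', mul_left_comm]
    exact key.trans ih

/-- For k < n the entry is the ballot difference C(2n-1, n-k) - C(2n-1, n-k-1). -/
lemma exists_int_catalanTriangle {n k : ℕ} (hn : 0 < n) (hk : k ≤ n) :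
    ∃ z : ℤ, catalanTriangle n k = z := by
  rcases Nat.eq_or_lt_of_le hk with rfl | hlt
  · exact ⟨1, by simp [catalanTriangle, hn.ne']⟩
  obtain ⟨d, rfl⟩ := Nat.exists_eq_add_of_lt hlt
  refine ⟨((2 * (k + d + 1) - 1).choose (d + 1) : ℤ) - (2 * (k + d + 1) - 1).choose d, ?_⟩
  have e0 : 2 * (k + d + 1) - 1 = (2 * k + d) + (d + 1) := by omega
  have h1 := Nat.choose_succ_right_eq (2 * (k + d + 1) - 1) d
  rw [e0, show (2 * k + d) + (d + 1) - d = 2 * k + d + 1 by omega] at h1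
  have h2 := Nat.choose_succ_succ ((2 * k + d) + (d + 1)) d
  have h1' : (((2 * k + d) + (d + 1)).choose (d + 1) : ℚ) * (d + 1) =
    (((2 * k + d) + (d + 1)).choose d : ℚ) * (2 * k + d + 1) := by exact_mod_cast h1
  rw [catalanTriangle, show k + d + 1 - k = d + 1 by omega,
    show 2 * (k + d + 1) = ((2 * k + d) + (d + 1)).succ by rw [Nat.succ_eq_add_one]; ring, h2]
  have hne : (k : ℚ) + d + 1 ≠ 0 := by positivity
  rw [Nat.succ_sub_one]
  push_cast
  rw [div_mul_eq_mul_div, div_eq_iff hne]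
  linear_combination -h1'

lemma catalanTriangle_eq {n k : ℕ} (hk : k ≤ n) :
    catalanTriangle n k = (k : ℚ) / n * ((2 * n).choose (n + k) : ℚ) := by
  rw [catalanTriangle, Nat.choose_symm_of_eq_add (by omega : 2 * n = (n - k) + (n + k))]

theorem theorem1p4 (n r s : ℕ) (hn : ∃ p a : ℕ, p.Prime ∧ n = p ^ a)
    (hs : 1 ≤ s) (hrs : ¬ r ≡ s [MOD 2]) :
    (∃ m : ℤ, ((2 * n).choose n : ℚ)⁻¹ *
      ∑ k ∈ Finset.Icc 1 n, (k : ℚ) ^ r * catalanTriangle n k ^ s = (m : ℚ)) ∨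
    IsHalfInteger (((2 * n).choose n : ℚ)⁻¹ *
      ∑ k ∈ Finset.Icc 1 n, (k : ℚ) ^ r * catalanTriangle n k ^ s) := by
  obtain ⟨p, a, hp, rfl⟩ := hn
  have hlucas := choose_two_mul_pow_sub_one_modEq hp a
  have hn0 : 0 < p ^ a := pow_pos hp.pos a
  have hcop : ∀ e : ℕ, IsCoprime (((2 * p ^ a - 1).choose (p ^ a - 1) : ℕ) : ℤ)
      (((p ^ a : ℕ) : ℤ) ^ e) := by
    intro e
    have hc : Nat.Coprime ((2 * p ^ a - 1).choose (p ^ a - 1)) p := by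
      rw [Nat.coprime_iff_gcd_eq_one, hlucas.gcd_eq, Nat.gcd_one_left]
    exact (Nat.isCoprime_iff_coprime.2 (hc.pow_right a)).pow_right
  have hcentral : (2 * p ^ a).choose (p ^ a) = 2 * (2 * p ^ a - 1).choose (p ^ a - 1) := by
    generalize p ^ a = n at *
    obtain ⟨n, rfl⟩ := Nat.exists_eq_add_of_le' hn0
    have := Nat.add_one_mul_choose_eq (2 * n + 1) n
    rw [show 2 * (n + 1) - 1 = 2 * n + 1 by omega, Nat.add_sub_cancel]
    rw [show 2 * (n + 1) = (2 * n + 1).succ by omega]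
    apply Nat.eq_of_mul_eq_mul_right (Nat.succ_pos n)
    simp only [Nat.succ_eq_add_one]
    rw [← this]
    ring
  have hC0 := choose_two_mul_ne_zero (p ^ a)
  generalize p ^ a = n at *
  obtain ⟨N, hN⟩ : ∃ N : ℤ,
      ∑ k ∈ Finset.Icc 1 n, (k : ℚ) ^ r * catalanTriangle n k ^ s = N := by
    have hB : ∀ k : ℕ, ∃ z : ℤ, k ≤ n → catalanTriangle n k = z := fun k => by
      by_cases hk : k ≤ n
      · obtain ⟨z, hz⟩ := exists_int_catalanTriangle hn0 hk
        exact ⟨z, fun _ => hz⟩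
      · exact ⟨0, fun h => absurd h hk⟩
    choose z hz using hB
    refine ⟨∑ k ∈ Finset.Icc 1 n, (k : ℤ) ^ r * z k ^ s, ?_⟩
    push_cast
    exact sum_congr rfl fun k hk => by rw [hz k (mem_Icc.1 hk).2]
  obtain ⟨t, ht⟩ : ∃ t, r + s = 2 * t + 1 := ⟨(r + s) / 2, by
    unfold Nat.ModEq at hrs; omega⟩
  obtain ⟨s, rfl⟩ := Nat.exists_eq_add_of_le' hs
  obtain ⟨T, hT⟩ := exists_int_sum_odd_pow_mul_choose_pow n t s
  have hn0' : (n : ℚ) ≠ 0 := Nat.cast_ne_zero.2 hn0.ne'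
  have hsum : ∑ k ∈ range (n + 1), (k : ℚ) ^ (2 * t + 1) *
      ((2 * n).choose (n + k) : ℚ) ^ (s + 1) = (N : ℚ) * n ^ (s + 1) := by
    rw [← hN, sum_mul]
    symm
    -- The extra term k = 0 vanishes because the exponent 2t + 1 is positive.
    refine sum_subset_zero_on_sdiff (fun k hk => ?_) (fun k hk => ?_) (fun k hk => ?_)
    · rw [mem_Icc] at hk; rw [mem_range]; omega
    · have : k = 0 := by
        rw [mem_sdiff, mem_range, mem_Icc] at hk; omega
      simp [this]
    · rw [catalanTriangle_eq (mem_Icc.1 hk).2, ← ht]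
      rw [mul_pow, div_pow, pow_add]
      field_simp
      ring
  rw [hN]
  -- The 2 in `hT` cancels the 2 in C(2n, n), and coprimality removes n^(s+1).
  have hdvd : (((2 * n - 1).choose (n - 1) : ℕ) : ℤ) ∣ N := by
    refine (hcop (s + 1)).dvd_of_dvd_mul_right ⟨T, ?_⟩
    rw [hsum, hcentral] at hT
    push_cast at hT
    have : (N : ℚ) * n ^ (s + 1) = ((2 * n - 1).choose (n - 1) : ℕ) * (T : ℚ) := by
      linear_combination hT / 2
    exact_mod_cast this
  obtain ⟨u, rfl⟩ := hdvd
  have hval : ((2 * n).choose n : ℚ)⁻¹ *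
      (((((2 * n - 1).choose (n - 1) : ℕ) : ℤ) * u : ℤ) : ℚ) = u / 2 := by
    rw [inv_mul_eq_iff_eq_mul₀ hC0, hcentral]
    push_cast
    ring
  rw [hval]
  rcases Int.even_or_odd' u with ⟨m, rfl | rfl⟩
  · exact Or.inl ⟨m, by push_cast; ring⟩
  · exact Or.inr ⟨m, by push_cast; ring⟩
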